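/- Let $f\colon X\to Y$ be a local homeomorphism between path-connected metric spaces, and let $\mathcal P$ be a family of continuous paths $p\colon[a,b]\to Y$ in $Y$ (on compact intervals $[a,b]$, which may depend on the path). Suppose that: (i) $Y$ is $\mathcal P$-connected: whenever $p\colon[a,b]\to Y$ belongs to $\mathcal P$, so does the reverse path $\bar p(t)=p(a-t+b)$, and every two points of $Y$ can be joined by a path in $\mathcal P$; (ii) $Y$ is locally $\mathcal P$-contractible: every $y_0\in Y$ has an open neighborhood $U$ for which there is a continuous map $H\colon U\times[0,1]\to U$ such that $H(y_0,t)=y_0$ for all $t\in[0,1]$, $H(y,0)=y_0$ and $H(y,1)=y$ for all $y\in U$, and for every $y\in U$ the path $t\mapsto H(y,t)$, $t\in[0,1]$, belongs to $\mathcal P$; (iii) either $Y$ is simply connected, or $\pi_1(X)$ and $\pi_1(Y)$ are isomorphic finite groups. Then $f$ is a homeomorphism of $X$ onto $Y$ if and only if $f$ has the continuation property for every path in $\mathcal P$. Here $f$ has the continuation property for a path $p\colon[a,b]\to Y$ if, for every $c\in(a,b]$ and every continuous $q\colon[a,c)\to X$ with $f\circ q=p$ on $[a,c)$, there is a sequence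 $(t_n)$ in $[a,c)$ converging to $c$ such that $(q(t_n))$ converges in $X$. -/

import Mathlib

open Set Filter Topology

/-- A continuous path `p : [a, b] → Y` in `Y`, defined on some compact interval. -/
structure IntervalPath (Y : Type*) [TopologicalSpace Y] where
  a : ℝ
  b : ℝ
  hab : a ≤ b
  toMap : C(Icc a b, Y)

namespace IntervalPath

variable {Y : Type*} [TopologicalSpace Y]

/-- The initial point `p(a)`. -/
def source (p : IntervalPath Y) : Y := p.toMap ⟨p.a, left_mem_Icc.2 p.hab⟩

/-- The final point `p(b)`. -/
def target (p : IntervalPath Y) : Y := p.toMap ⟨p.b, right_mem_Icc.2 p.hab⟩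

/-- The reverse path `t ↦ p(a - t + b)`, on the same interval `[a, b]`. -/
def reverse (p : IntervalPath Y) : IntervalPath Y where
  a := p.a
  b := p.b
  hab := p.hab
  toMap := p.toMap.comp
    ⟨fun t => ⟨p.a - (t : ℝ) + p.b, by
        have h1 := t.2.1
        have h2 := t.2.2
        constructor <;> linarith⟩, by fun_prop⟩

end IntervalPath

/-- `Y` is `P`-connected: the family `P` is closed under reversal of paths, and any two points
of `Y` are joined by a path in `P`. -/
def IsPConnected (Y : Type*) [TopologicalSpace Y] (P : Set (IntervalPath Y)) : Prop :=
  (∀ p ∈ P, p.reverse ∈ P) ∧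
    ∀ y₁ y₂ : Y, ∃ p ∈ P, p.source = y₁ ∧ p.target = y₂

/-- Given `H : U × [0,1] → U` with `U ⊆ Y`, the path `p_y(t) = H(y, t)` of `Y` on `[0,1]`. -/
def homotopyPath {Y : Type*} [TopologicalSpace Y] {U : Set Y}
    (H : C(U × Icc (0 : ℝ) 1, U)) (y : U) : IntervalPath Y where
  a := 0
  b := 1
  hab := zero_le_one
  toMap := ⟨fun t => (H (y, t) : Y), by fun_prop⟩

/-- `Y` is locally `P`-contractible: each point `y₀` has an open neighbourhood `U` with a
(continuous) homotopy `H : U × [0,1] → U` that fixes `y₀`, goes from the constant map `y₀` to the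
identity, and has all its paths `t ↦ H(y, t)` in `P`. -/
def IsLocallyPContractible (Y : Type*) [TopologicalSpace Y] (P : Set (IntervalPath Y)) : Prop :=
  ∀ y₀ : Y, ∃ (U : Set Y) (hy₀ : y₀ ∈ U), IsOpen U ∧
    ∃ H : C(U × Icc (0 : ℝ) 1, U),
      (∀ t, H (⟨y₀, hy₀⟩, t) = ⟨y₀, hy₀⟩) ∧
      (∀ y, H (y, ⟨0, by norm_num⟩) = ⟨y₀, hy₀⟩ ∧ H (y, ⟨1, by norm_num⟩) = y) ∧
      (∀ y, homotopyPath H y ∈ P)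

/-- `f` has the continuation property for the path `p : [a, b] → Y`: for every `c ∈ (a, b]` and
every continuous `q : [a, c) → X` with `f ∘ q = p` on `[a, c)`, there is a sequence `(t n)` in
`[a, c)` converging to `c` such that `q (t n)` converges in `X`. -/
def HasContinuationProperty {X Y : Type*} [TopologicalSpace X] [TopologicalSpace Y]
    (f : X → Y) (p : IntervalPath Y) : Prop :=
  ∀ (c : ℝ) (hc : c ∈ Ioc p.a p.b) (q : C(Ico p.a c, X)),
    (∀ t : Ico p.a c, f (q t) = p.toMap ⟨t, t.2.1, t.2.2.le.trans hc.2⟩) →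
    ∃ t : ℕ → Ico p.a c, Tendsto (fun n => (t n : ℝ)) atTop (𝓝 c) ∧
      ∃ x : X, Tendsto (fun n => q (t n)) atTop (𝓝 x)

/-! The continuation property lets every path of `P` lift from any point over its source: the set of
times up to which a lift exists is closed by continuation and open by local inverses of `f`. Lifting
the contraction paths of `U` and their reverses identifies `f ⁻¹' U` with `U` times the fibre, so
`f` is a covering map. Lifting paths of `P` that join points gives surjectivity. Hypothesis (iii)
makes `f` surjective on fundamental groups, hence injective as `X` is path connected; a bijective
local homeomorphism is a homeomorphism. Conversely, a lift `q` of `p` equals `f⁻¹ ∘ p`, which has a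
limit at `c`. -/

/-! ### Lifting paths -/

/-- `q` is a lift through `f` of the restriction of `γ` to `[a, t]`, starting at `x`. -/
structure IsLiftOn {X Y : Type*} [TopologicalSpace X] (f : X → Y) (γ : ℝ → Y) (a : ℝ) (x : X)
    (t : ℝ) (q : ℝ → X) : Prop where
  continuousOn : ContinuousOn q (Icc a t)
  lifts : ∀ s ∈ Icc a t, f (q s) = γ s
  start : q a = x

namespace IsLiftOn

variable {X Y : Type*} [TopologicalSpace X] {f : X → Y} {γ : ℝ → Y}
  {a t : ℝ} {x : X} {q q' : ℝ → X}

theorem mono (h : IsLiftOn f γ a x t q) {s : ℝ} (hst : s ≤ t) : IsLiftOn f γ a x s q :=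
  ⟨h.continuousOn.mono (Icc_subset_Icc_right hst),
    fun r hr => h.lifts r (Icc_subset_Icc_right hst hr), h.start⟩

theorem eqOn [T2Space X] [TopologicalSpace Y] (hf : IsLocalHomeomorph f) (h : IsLiftOn f γ a x t q)
    (h' : IsLiftOn f γ a x t q') : EqOn q q' (Icc a t) := by
  rcases lt_or_ge t a with hta | hat
  · simp [Icc_eq_empty_of_lt hta]
  · exact (T2Space.isSeparatedMap f).eqOn_of_comp_eqOn hf.isLocallyInjective isPreconnected_Icc
      h.continuousOn h'.continuousOn (fun s hs => (h.lifts s hs).trans (h'.lifts s hs).symm)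
      (left_mem_Icc.2 hat) (h.start.trans h'.start.symm)

/-- A lift on `[a, t]` extends along a local inverse of `f`. -/
theorem extend [TopologicalSpace Y] (hγ : Continuous γ) (h : IsLiftOn f γ a x t q) (hat : a ≤ t)
    {d : ℝ} (e : OpenPartialHomeomorph X Y) (he : f = e) (hq : q t ∈ e.source)
    (hd : MapsTo γ (Icc t d) e.target) : ∃ q', IsLiftOn f γ a x d q' := by
  set q' : ℝ → X := fun s => if s ≤ t then q s else e.symm (γ s) with hq'
  have h1 : EqOn q' q (Icc a t) := fun s hs => if_pos hs.2
  have h2 : EqOn q' (e.symm ∘ γ) (Icc t d) := by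
    intro s hs
    by_cases hst : s ≤ t
    · obtain rfl : s = t := le_antisymm hst hs.1
      simp only [hq', le_refl, if_true, Function.comp]
      rw [← h.lifts s ⟨hat, le_rfl⟩, he, e.left_inv hq]
    · simp [hq', hst]
  have hsub : Icc a d ⊆ Icc a t ∪ Icc t d := fun s hs =>
    (le_total s t).imp (fun hst => ⟨hs.1, hst⟩) (fun hst => ⟨hst, hs.2⟩)
  refine ⟨q', ContinuousOn.mono ?_ hsub, fun s hs => ?_, ?_⟩
  · exact (h.continuousOn.congr h1).union_of_isClosed
      ((e.continuousOn_symm.comp hγ.continuousOn hd).congr h2) isClosed_Icc isClosed_Icc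
  · rcases hsub hs with hs | hs
    · rw [h1 hs, h.lifts s hs]
    · rw [h2 hs, he, Function.comp, e.right_inv (hd hs)]
  · rw [h1 (left_mem_Icc.2 hat), h.start]

end IsLiftOn

/-- If lifts exist up to every time before `c`, they glue to a lift on `[a, c)`. -/
theorem exists_continuous_lift_Ico {X Y : Type*} [TopologicalSpace X] [T2Space X]
    [TopologicalSpace Y] {f : X → Y} (hf : IsLocalHomeomorph f) {γ : ℝ → Y} {a c : ℝ} {x : X}
    (h : ∀ t ∈ Ico a c, ∃ q, IsLiftOn f γ a x t q) :
    ∃ q : C(Ico a c, X), ∀ t : Ico a c, ∃ Q, IsLiftOn f γ a x t Q ∧ Q t = q t := by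
  have : Nonempty X := ⟨x⟩
  choose! Q hQ using h
  -- By uniqueness of lifts, the chosen `Q s` agree near any time with a single `Q d`, which yields
  -- continuity.
  have key : ∀ s ∈ Ico a c, ∀ t ∈ Ico a c, s ≤ t → Q s s = Q t s := fun s hs t ht hst =>
    (hQ s hs).eqOn hf ((hQ t ht).mono hst) (right_mem_Icc.2 hs.1)
  refine ⟨⟨fun t => Q t t, continuous_iff_continuousAt.2 fun t => ?_⟩,
    fun t => ⟨Q t, hQ t t.2, rfl⟩⟩
  obtain ⟨d, htd, hdc⟩ := exists_between t.2.2
  have hd : d ∈ Ico a c := ⟨t.2.1.trans htd.le, hdc⟩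
  have h1 : ∀ᶠ s : Ico a c in 𝓝 t, (s : ℝ) < d :=
    continuous_subtype_val.continuousAt.eventually_lt continuousAt_const htd
  have h2 : Tendsto (fun s : Ico a c => (s : ℝ)) (𝓝 t) (𝓝[Icc a d] (t : ℝ)) :=
    tendsto_nhdsWithin_iff.2 ⟨continuous_subtype_val.continuousAt,
      h1.mono fun s hs => ⟨s.2.1, hs.le⟩⟩
  have h3 := ((hQ d hd).continuousOn t ⟨t.2.1, htd.le⟩).tendsto.comp h2
  rw [← key t t.2 d hd htd.le] at h3
  exact h3.congr' (h1.mono fun s hs => (key s s.2 d hd hs.le).symm)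

/-- Through a local homeomorphism, a path with the continuation property can be lifted. -/
theorem HasContinuationProperty.exists_lift {X Y : Type*} [TopologicalSpace X] [T2Space X]
    [TopologicalSpace Y] [T2Space Y] {f : X → Y} (hf : IsLocalHomeomorph f) {p : IntervalPath Y}
    (hp : HasContinuationProperty f p) {x : X} (hx : f x = p.source) :
    ∃ q : C(Icc p.a p.b, X), q ⟨p.a, left_mem_Icc.2 p.hab⟩ = x ∧ ∀ t, f (q t) = p.toMap t := by
  set γ : ℝ → Y := IccExtend p.hab p.toMap with hγdef
  have hγ : Continuous γ := p.toMap.continuous.Icc_extend'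
  have hγp : ∀ t (ht : t ∈ Icc p.a p.b), γ t = p.toMap ⟨t, ht⟩ := fun t ht =>
    IccExtend_of_mem _ _ ht
  suffices ∃ q, IsLiftOn f γ p.a x p.b q by
    obtain ⟨q, hq⟩ := this
    exact ⟨⟨fun t => q t, continuousOn_iff_continuous_domRestrict.1 hq.continuousOn⟩, hq.start,
      fun t => (hq.lifts t t.2).trans (hγp t t.2)⟩
  set S : Set ℝ := {t | t ∈ Icc p.a p.b ∧ ∃ q, IsLiftOn f γ p.a x t q} with hS
  have haS : p.a ∈ S := ⟨left_mem_Icc.2 p.hab, fun _ => x, continuousOn_const, fun s hs => by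
    rw [le_antisymm hs.2 hs.1, hx, hγp _ (left_mem_Icc.2 p.hab)]; rfl, rfl⟩
  have hbdd : BddAbove S := ⟨p.b, fun t ht => ht.1.2⟩
  set c := sSup S with hc
  have hac : p.a ≤ c := le_csSup hbdd haS
  have hcb : c ≤ p.b := csSup_le ⟨_, haS⟩ fun t ht => ht.1.2
  -- The point to continue through at the supremum `c`: `x` itself if `c = p.a`, otherwise the limit
  -- given by the continuation property.
  obtain ⟨z, hz, hzc⟩ : ∃ z, f z = γ c ∧ ∀ V ∈ 𝓝 z, ∀ W ∈ 𝓝 c,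
      ∃ t ∈ W, t ∈ Icc p.a c ∧ ∃ q, IsLiftOn f γ p.a x t q ∧ q t ∈ V := by
    rcases hac.eq_or_lt with hac | hac
    · obtain ⟨-, q, hq⟩ := haS
      refine ⟨x, ?_, fun V hV W hW => ⟨p.a, ?_, ⟨le_rfl, hac.le⟩, q, hq, ?_⟩⟩
      · rw [← hac, hx, hγp _ (left_mem_Icc.2 p.hab)]; rfl
      · rw [hac]; exact mem_of_mem_nhds hW
      · rw [hq.start]; exact mem_of_mem_nhds hV
    · obtain ⟨q, hq⟩ := exists_continuous_lift_Ico hf (γ := γ) (a := p.a) (c := c) (x := x) <| by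
        intro t ht
        obtain ⟨s, hs, hts⟩ := exists_lt_of_lt_csSup ⟨_, haS⟩ ht.2
        obtain ⟨-, q, hq⟩ := hs
        exact ⟨q, hq.mono hts.le⟩
      have hfq : ∀ t : Ico p.a c, f (q t) = γ t := fun t => by
        obtain ⟨Q, hQ, hQt⟩ := hq t
        rw [← hQt, hQ.lifts t (right_mem_Icc.2 t.2.1)]
      obtain ⟨t, htc, z, hz⟩ := hp c ⟨hac, hcb⟩ q fun t =>
        (hfq t).trans (hγp t ⟨t.2.1, t.2.2.le.trans hcb⟩)
      refine ⟨z, tendsto_nhds_unique ((hf.continuous.tendsto z).comp hz)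
        (((hγ.tendsto c).comp htc).congr fun n => (hfq _).symm), fun V hV W hW => ?_⟩
      obtain ⟨n, hnV, hnW⟩ := ((hz.eventually_mem hV).and (htc.eventually_mem hW)).exists
      obtain ⟨Q, hQ, hQt⟩ := hq (t n)
      exact ⟨t n, hnW, ⟨(t n).2.1, (t n).2.2.le⟩, Q, hQ, hQt ▸ hnV⟩
  obtain ⟨e, hze, he⟩ := hf z
  have hW : γ ⁻¹' e.target ∈ 𝓝 c := hγ.continuousAt.preimage_mem_nhds
    (e.open_target.mem_nhds (by rw [← hz, he]; exact e.map_source hze))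
  obtain ⟨ε, hε, hεW⟩ := Metric.mem_nhds_iff.1 hW
  rw [Real.ball_eq_Ioo] at hεW
  obtain ⟨t, ht, htc, q, hq, hqt⟩ := hzc _ (e.open_source.mem_nhds hze) _
    (Ioo_mem_nhds (sub_lt_self c hε) (lt_add_of_pos_right c hε))
  -- The new lift passes `c` unless `c = p.b`; since `c` is the supremum, it reaches `p.b`.
  obtain ⟨q', hq'⟩ := hq.extend hγ htc.1 e he hqt (d := min (c + ε / 2) p.b) fun s hs =>
    hεW ⟨ht.1.trans_le hs.1, (hs.2.trans (min_le_left _ _)).trans_lt (by linarith)⟩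
  have hle : min (c + ε / 2) p.b ≤ c := le_csSup hbdd
    ⟨⟨le_min (by linarith) p.hab, min_le_right _ _⟩, q', hq'⟩
  rcases min_le_iff.1 hle with h | h
  · linarith
  · exact ⟨q', hq'.mono (le_min (by linarith) le_rfl)⟩

/-! ### From path lifting to a covering map -/

section Covering

open scoped unitInterval

/-- A homotopy whose time paths all lift through a separated local homeomorphism lifts. -/
theorem IsLocalHomeomorph.exists_homotopy_lift {E X A : Type*} [TopologicalSpace E]
    [TopologicalSpace X] [TopologicalSpace A] {p : E → X} (hp : IsLocalHomeomorph p)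
    (sep : IsSeparatedMap p) (F : C(I × A, X)) (g : C(A, E))
    (h : ∀ a, ∃ γ : C(I, E), γ 0 = g a ∧ ∀ t, p (γ t) = F (t, a)) :
    ∃ G : C(I × A, E), (∀ a, G (0, a) = g a) ∧ ∀ ta, p (G ta) = F ta := by
  choose γ h0 hγ using h
  refine ⟨⟨fun ta => γ ta.2 ta.1, ?_⟩, h0, fun ta => hγ _ _⟩
  refine hp.continuous_lift sep F (funext fun ta => hγ _ _) ?_ fun a => (γ a).continuous
  simpa only [h0] using g.continuous

/-- A separated local homeomorphism is evenly covered over an open set that contracts to `y₀` along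
paths which, together with their reverses, can be lifted. -/
theorem IsLocalHomeomorph.isEvenlyCovered_of_contraction {X Y : Type*} [TopologicalSpace X]
    [TopologicalSpace Y] {f : X → Y} (hf : IsLocalHomeomorph f) (sep : IsSeparatedMap f)
    {y₀ : Y} {U : Set Y} (hU : IsOpen U) (hy₀ : y₀ ∈ U) (K : C(U × I, U))
    (K0 : ∀ y, K (y, 0) = ⟨y₀, hy₀⟩) (K1 : ∀ y, K (y, 1) = y)
    (lift : ∀ y x, f x = y₀ → ∃ γ : C(I, X), γ 0 = x ∧ ∀ t, f (γ t) = K (y, t))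
    (lift_symm : ∀ (y : U) x, f x = y →
      ∃ γ : C(I, X), γ 0 = x ∧ ∀ t, f (γ t) = K (y, unitInterval.symm t)) :
    IsEvenlyCovered f y₀ (f ⁻¹' {y₀}) := by
  have disc : DiscreteTopology (f ⁻¹' {y₀}) := by
    have : DiscreteTopology (f '' (f ⁻¹' {y₀})) :=
      have := (subsingleton_coe _).2 (subsingleton_singleton.anti (image_preimage_subset f {y₀}))
      inferInstance
    exact hf.isLocalHomeomorphOn.discreteTopology_of_image
  obtain ⟨G, G0, hG⟩ := hf.exists_homotopy_lift sep (A := U × f ⁻¹' {y₀})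
    ⟨fun ta => (K (ta.2.1, ta.1) : Y), by fun_prop⟩ ⟨fun a => (a.2 : X), by fun_prop⟩
    fun a => lift a.1 a.2 a.2.2
  obtain ⟨B, B0, hB⟩ := hf.exists_homotopy_lift sep (A := f ⁻¹' U)
    ⟨fun ta => (K (⟨f ta.2, ta.2.2⟩, unitInterval.symm ta.1) : Y), by
      have := hf.continuous; fun_prop⟩ ⟨fun a => (a : X), by fun_prop⟩
    fun a => lift_symm ⟨f a, a.2⟩ a rfl
  simp only [ContinuousMap.coe_mk] at G0 hG B0 hB
  have hG1 : ∀ a, f (G (1, a)) = a.1 := fun a => by rw [hG, K1]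
  have hB1 : ∀ z, f (B (1, z)) = y₀ := fun z => by rw [hB, unitInterval.symm_one, K0]
  have uniq : ∀ g₁ g₂ : I → X, Continuous g₁ → Continuous g₂ → f ∘ g₁ = f ∘ g₂ → ∀ s t : I,
      g₁ s = g₂ s → g₁ t = g₂ t := fun g₁ g₂ h₁ h₂ h s t hs =>
    congr_fun (sep.eq_of_comp_eq hf.isLocallyInjective h₁ h₂ h s hs) t
  refine ⟨disc, U, hy₀, hU, hU.preimage hf.continuous,
    { toFun := fun z => (⟨f z, z.2⟩, ⟨B (1, z), hB1 z⟩)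
      invFun := fun a => ⟨G (1, a), by rw [mem_preimage, hG1]; exact a.1.2⟩
      left_inv := fun z => ?_
      right_inv := fun a => ?_
      continuous_toFun := ?_
      continuous_invFun := ?_ }, fun z => rfl⟩
  · refine Subtype.ext ?_
    -- Two lifts of the contraction path of `f z`, both starting at `B (1, z)`; at time `1` the
    -- second one is at `z`.
    have := uniq (fun t => G (t, (⟨f z, z.2⟩, ⟨B (1, z), hB1 z⟩)))
      (fun t => B (unitInterval.symm t, z)) (by fun_prop) (by fun_prop)
      (funext fun t => by simp [hG, hB]) 0 1 (by simp [G0])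
    simpa [B0] using this
  · have ha : f (G (1, a)) ∈ U := by rw [hG1]; exact a.1.2
    have ha' : (⟨f (G (1, a)), ha⟩ : U) = a.1 := Subtype.ext (hG1 a)
    refine Prod.ext ha' (Subtype.ext ?_)
    have := uniq (fun t => B (t, ⟨G (1, a), ha⟩)) (fun t => G (unitInterval.symm t, a))
      (by fun_prop) (by fun_prop) (funext fun t => by simp [hG, hB, K1]) 0 1 (by simp [B0])
    simpa [G0] using this
  · have := hf.continuous
    fun_prop
  · fun_prop

theorem isCoveringMap_of_hasContinuationProperty {X Y : Type*} [TopologicalSpace X] [T2Space X]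
    [TopologicalSpace Y] [T2Space Y] {P : Set (IntervalPath Y)} (hrev : ∀ p ∈ P, p.reverse ∈ P)
    (hcontr : IsLocallyPContractible Y P) {f : X → Y} (hf : IsLocalHomeomorph f)
    (hP : ∀ p ∈ P, HasContinuationProperty f p) : IsCoveringMap f := by
  intro y₀
  obtain ⟨U, hy₀, hU, H, -, hH, hHP⟩ := hcontr y₀
  have H0 : ∀ y, H (y, 0) = ⟨y₀, hy₀⟩ := fun y => (hH y).1
  have H1 : ∀ y, H (y, 1) = y := fun y => (hH y).2
  refine hf.isEvenlyCovered_of_contraction (T2Space.isSeparatedMap f) hU hy₀ H H0 H1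
    (fun y x hx => ?_) (fun y x hx => ?_)
  · exact (hP _ (hHP y)).exists_lift hf (hx.trans (congrArg Subtype.val (H0 y)).symm)
  · have key : ∀ t : I, (homotopyPath H y).reverse.toMap t = (H (y, unitInterval.symm t) : Y) := by
      intro t
      have : (⟨0 - (t : ℝ) + 1, by have := t.2.1; have := t.2.2; constructor <;> linarith⟩ : I) =
          unitInterval.symm t := Subtype.ext (by rw [unitInterval.coe_symm_eq]; ring)
      rw [← this]; rfl
    obtain ⟨q, hq0, hq⟩ := (hP _ (hrev _ (hHP y))).exists_lift hf (x := x) <| by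
      refine Eq.trans ?_ (key 0).symm
      rw [unitInterval.symm_zero, H1, hx]
    exact ⟨q, hq0, fun t => (hq t).trans (key t)⟩

/-! ### Injectivity from fundamental groups -/

/-- A covering map with path connected total space that is surjective on a fundamental group is
injective. -/
theorem IsCoveringMap.injective_of_surjective_map {E X : Type*} [TopologicalSpace E]
    [TopologicalSpace X] [PathConnectedSpace E] {p : E → X} (cov : IsCoveringMap p)
    (h : ∀ e, Function.Surjective (FundamentalGroup.map ⟨p, cov.continuous⟩ e)) :
    Function.Injective p := by
  intro e₁ e₂ he
  let γ := PathConnectedSpace.somePath e₁ e₂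
  let γ' : Path (p e₁) (p e₁) := (γ.map cov.continuous).cast rfl he
  obtain ⟨g, hg⟩ := h e₁ (FundamentalGroup.fromPath (.mk γ'))
  -- Transport along the class of `γ'` fixes `e₁`, because `g` is a loop lifting that class, and
  -- sends `e₁` to `e₂`, because `γ` lifts `γ'`.
  have h1 := cov.monodromy_map (FundamentalGroup.toPath g)
  have h2 : cov.monodromy (.mk γ') ⟨e₁, rfl⟩ = ⟨e₂, he.symm⟩ :=
    cov.monodromy_eq_of_map_eq (ex := ⟨e₁, rfl⟩) (ey := ⟨e₂, he.symm⟩) (.mk γ) rfl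
  have h3 : (FundamentalGroup.toPath g).map ⟨p, cov.continuous⟩ = .mk γ' := hg
  rw [h3] at h1
  exact congrArg Subtype.val (h1.symm.trans h2)

/-- A covering map is injective on fundamental groups, and an injection between finite sets of equal
cardinality is onto; path connectedness frees the choice of base points. -/
theorem IsCoveringMap.surjective_map_of_finite {E X : Type*} [TopologicalSpace E]
    [TopologicalSpace X] [PathConnectedSpace E] [PathConnectedSpace X] {p : E → X}
    (cov : IsCoveringMap p) {e₀ : E} {x₀ : X}
    (φ : FundamentalGroup E e₀ ≃* FundamentalGroup X x₀) [Finite (FundamentalGroup X x₀)] (e : E) :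
    Function.Surjective (FundamentalGroup.map ⟨p, cov.continuous⟩ e) := by
  let ψ : FundamentalGroup E e ≃* FundamentalGroup X (p e) :=
    (FundamentalGroup.fundamentalGroupMulEquivOfPathConnected e e₀).trans
      (φ.trans (FundamentalGroup.fundamentalGroupMulEquivOfPathConnected x₀ (p e)))
  have : Finite (FundamentalGroup X (p e)) := Finite.of_equiv _
    (FundamentalGroup.fundamentalGroupMulEquivOfPathConnected x₀ (p e)).toEquiv
  have : Finite (FundamentalGroup E e) := Finite.of_equiv _ ψ.symm.toEquiv
  have hinj : Function.Injective (FundamentalGroup.map ⟨p, cov.continuous⟩ e) :=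
    cov.injective_path_homotopic_map e e
  exact (Finite.injective_iff_surjective_of_equiv ψ.toEquiv).1 hinj

end Covering

theorem mainTheorem7 {X Y : Type*} [MetricSpace X] [MetricSpace Y]
    [PathConnectedSpace X] [PathConnectedSpace Y]
    (P : Set (IntervalPath Y)) (hconn : IsPConnected Y P) (hcontr : IsLocallyPContractible Y P)
    (f : X → Y) (hf : IsLocalHomeomorph f)
    (hπ : SimplyConnectedSpace Y ∨
      ∃ (x : X) (y : Y), Nonempty (FundamentalGroup X x ≃* FundamentalGroup Y y) ∧
        Finite (FundamentalGroup Y y)) :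
    IsHomeomorph f ↔ ∀ p ∈ P, HasContinuationProperty f p := by
  constructor
  · intro h p _ c hc q hq
    obtain ⟨u, -, hu, huc⟩ := exists_seq_strictMono_tendsto' hc.1
    let t : ℕ → Ico p.a c := fun n => ⟨u n, (hu n).1.le, (hu n).2⟩
    refine ⟨t, huc, (h.homeomorph f).symm (p.toMap ⟨c, hc.1.le, hc.2⟩), ?_⟩
    have hqt : ∀ n, q (t n) = (h.homeomorph f).symm
        (p.toMap ⟨t n, (t n).2.1, (t n).2.2.le.trans hc.2⟩) := fun n => by
      rw [← hq]; exact ((h.homeomorph f).symm_apply_apply _).symm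
    simp only [hqt]
    exact (((h.homeomorph f).symm.continuous.comp p.toMap.continuous).tendsto _).comp
      (tendsto_subtype_rng.2 huc)
  · intro hP
    have cov := isCoveringMap_of_hasContinuationProperty hconn.1 hcontr hf hP
    have hsurj : Function.Surjective f := fun y => by
      obtain ⟨x⟩ := PathConnectedSpace.nonempty (X := X)
      obtain ⟨p, hpP, hpx, rfl⟩ := hconn.2 (f x) y
      obtain ⟨q, -, hq⟩ := (hP p hpP).exists_lift hf hpx.symm
      exact ⟨_, hq ⟨p.b, right_mem_Icc.2 p.hab⟩⟩
    have hinj : Function.Injective f := by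
      refine cov.injective_of_surjective_map fun x => ?_
      rcases hπ with hY | ⟨x₀, y₀, ⟨φ⟩, hfin⟩
      · have : Subsingleton (FundamentalGroup Y (f x)) := inferInstance
        exact fun g => ⟨1, Subsingleton.elim (α := FundamentalGroup Y (f x)) _ _⟩
      · exact cov.surjective_map_of_finite φ x
    exact (hf.toHomeomorphOfBijective ⟨hinj, hsurj⟩).isHomeomorph
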